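/- Let $q$ be a complex number with $0<|q|<1$. Write $(a;p)_n=\prod_{i=0}^{n-1}(1-ap^i)$, $(a;p)_\infty=\prod_{i\ge 0}(1-ap^i)$, $(a_1,a_2,a_3;p)_\infty=(a_1;p)_\infty(a_2;p)_\infty(a_3;p)_\infty$, and $(q)_n=(q;q)_n$, $(q)_\infty=(q;q)_\infty$. **Theorem (Binomial extension of the Kurşungöz identities).** Let $j,r\ge 0$ and $k\ge 1$ be integers such that $j+r\le k$. Then $$\sum_{s_1\ge\cdots\ge s_k\ge 0} q^{s_1^2+\cdots+s_k^2+s_{k-r+1}+\cdots+s_{k-1}+2s_k}\cdot\frac{q^{-s_1-\cdots-s_j}(1+q^{s_1+s_2})(1+q^{s_2+s_3})\cdots(1+q^{s_{j-1}+s_j})}{(q)_{s_1-s_2}\cdots(q)_{s_{k-1}-s_k}(q^2;q^2)_{s_k}}$$ $$=\frac{1}{1+q}\sum_{s=0}^{j}\binom{j}{s}\left(\frac{(q^{2k+2},q^{k+2-r+j-2s},q^{k+r-j+2s};q^{2k+2})_\infty}{(q)_\infty}+q\,\frac{(q^{2k+2},q^{k-r+j-2s},q^{k+2+r-j+2s};q^{2k+2})_\infty}{(q)_\infty}\right),$$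 where the multisum converges absolutely. Here the linear part $s_{k-r+1}+\cdots+s_{k-1}+2s_k$ of the exponent means $\bigl(\sum_{i=k-r+1}^{k}s_i\bigr)+s_k$, so that it is $s_k$ when $r=0$; for $j\le 1$ the product $(1+q^{s_1+s_2})\cdots(1+q^{s_{j-1}+s_j})$ is empty. Moreover, the identity remains true, with the same right-hand side, if the $j$ factors $q^{-s_1}$ and $q^{-s_i}(1+q^{s_{i-1}+s_i})$, $2\le i\le j$, are replaced by the elements of any $j$-element subset of $$\{q^{-s_1}\}\cup\{q^{-s_i}(1+q^{s_{i-1}+s_i}) : 2\le i\le k-r\}.$$ -/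

import Mathlib

open Finset

noncomputable section

/-- The finite `q`-Pochhammer symbol `(a; p)_n = ∏_{i < n} (1 - a p^i)`. -/
def qPoch (a p : ℂ) (n : ℕ) : ℂ := ∏ i ∈ Finset.range n, (1 - a * p ^ i)

/-- The infinite `q`-Pochhammer symbol `(a; p)_∞ = ∏_{i ≥ 0} (1 - a p^i)`
(used only for `‖p‖ < 1`, where the product converges). -/
def qPochInf (a p : ℂ) : ℂ := ∏' i : ℕ, (1 - a * p ^ i)

/-- `(a, b, c; p)_∞ = (a; p)_∞ (b; p)_∞ (c; p)_∞`. -/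
def qPochInf₃ (a b c p : ℂ) : ℂ := qPochInf a p * qPochInf b p * qPochInf c p

/-- The summation range `s_1 ≥ s_2 ≥ ⋯ ≥ s_k ≥ 0`. -/
abbrev WeakDecr (k : ℕ) : Type := {s : Fin k → ℕ // Antitone s}

/-- The entry `s_i` with the index counted from `1`, for `1 ≤ i ≤ k`
(entries outside this range are `0` and do not occur below). -/
def WeakDecr.entry {k : ℕ} (s : WeakDecr k) (i : ℕ) : ℕ :=
  if h : 1 ≤ i ∧ i ≤ k then s.1 ⟨i - 1, by omega⟩ else 0

/-- The exponent `s_1² + ⋯ + s_k² + s_{k-r+1} + ⋯ + s_{k-1} + 2 s_k`, read as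
`(s_1² + ⋯ + s_k²) + (s_{k-r+1} + ⋯ + s_k) + s_k`; the middle sum is empty for `r = 0`. -/
def kurExponent {k : ℕ} (r : ℕ) (s : WeakDecr k) : ℕ :=
  (∑ i ∈ Finset.Icc 1 k, s.entry i ^ 2) + (∑ i ∈ Finset.Icc (k - r + 1) k, s.entry i) + s.entry k

/-- The denominator `(q)_{s_1 - s_2} ⋯ (q)_{s_{k-1} - s_k} (q²; q²)_{s_k}`. -/
def kurDenom {k : ℕ} (q : ℂ) (s : WeakDecr k) : ℂ :=
  (∏ i ∈ Finset.Icc 1 (k - 1), qPoch q q (s.entry i - s.entry (i + 1))) *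
    qPoch (q ^ 2) (q ^ 2) (s.entry k)

/-- The `i`-th allowed factor: `q^{-s_1}` for `i = 1`, and `q^{-s_i} (1 + q^{s_{i-1} + s_i})`
for `i ≥ 2`. -/
def kurFactor {k : ℕ} (q : ℂ) (s : WeakDecr k) (i : ℕ) : ℂ :=
  if i = 1 then q ^ (-(s.entry 1 : ℤ))
  else q ^ (-(s.entry i : ℤ)) * (1 + q ^ (s.entry (i - 1) + s.entry i))

/-- The product side
`1/(1+q) ∑_{s=0}^{j} C(j,s) ( (q^{2k+2}, q^{k+2-r+j-2s}, q^{k+r-j+2s}; q^{2k+2})_∞ / (q)_∞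
  + q (q^{2k+2}, q^{k-r+j-2s}, q^{k+2+r-j+2s}; q^{2k+2})_∞ / (q)_∞ )`,
with exponents computed in `ℤ`. -/
def kurProductSide (k r j : ℕ) (q : ℂ) : ℂ :=
  1 / (1 + q) * ∑ s ∈ Finset.range (j + 1), (j.choose s : ℂ) *
    (qPochInf₃ (q ^ (2 * k + 2)) (q ^ ((k : ℤ) + 2 - r + j - 2 * s))
        (q ^ ((k : ℤ) + r - j + 2 * s)) (q ^ (2 * k + 2)) / qPochInf q q
      + q * (qPochInf₃ (q ^ (2 * k + 2)) (q ^ ((k : ℤ) - r + j - 2 * s))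
        (q ^ ((k : ℤ) + 2 + r - j + 2 * s)) (q ^ (2 * k + 2)) / qPochInf q q))

end


/-!
A Bailey pair relative to `q ^ a` is written bilaterally, as
`β_L = ∑_{n ∈ ℤ} α_n / ((q)_{L-n} (q)_{L+n+a})`. Summing the multisum from `s_k` up to `s_1`, each
summation replaces a Bailey pair by another one, and by `q`-Vandermonde its effect on `α_n` is the
multiplication by `q^{n²+n}` (for `a = 1` and `q^{s²+s}`), by `q^{n²}` (for `a = 0` and `q^{s²}`),
or by `q^{n²} (q^n + q^{-n})` (for `a = 0` and `q^{s²-s} (1 + q^{L+s})`). Since multiplications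
commute, only the number of the extra factors matters, not their positions. The passage from
`a = 1` to `a = 0` is a summation by parts, which creates the two terms on the product side.

The step for `s_1` carries the factor `1 / (q)_{L-s_1}`, and `1 + q^{L+s_1}` if `q^{-s_1}` is among
the extra factors, neither of which is in the multisum; as `L → ∞` they tend to `1 / (q)_∞` and `1`.
In the limit `∑ α_n` remains. It is evaluated by expanding `(q^n + q^{-n})^j` with the binomial
theorem and applying the Jacobi triple product to each term.
-/
open Filter Topology

section QFactorial

variable {q : ℂ}

theorem norm_sq_lt_one (hq : ‖q‖ < 1) : ‖q ^ 2‖ < 1 := by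
  rw [norm_pow]
  exact pow_lt_one₀ (norm_nonneg q) hq two_ne_zero

theorem one_sub_pow_succ_ne_zero (hq : ‖q‖ < 1) (n : ℕ) : 1 - q ^ (n + 1) ≠ 0 := by
  refine (isUnit_one_sub_of_norm_lt_one ?_).ne_zero
  rw [norm_pow]
  exact pow_lt_one₀ (norm_nonneg q) hq n.succ_ne_zero

theorem one_add_ne_zero_of_norm_lt_one (hq : ‖q‖ < 1) : 1 + q ≠ 0 := by
  simpa using (isUnit_one_sub_of_norm_lt_one (x := -q) (by rwa [norm_neg])).ne_zero

theorem qPoch_succ (a p : ℂ) (n : ℕ) : qPoch a p (n + 1) = qPoch a p n * (1 - a * p ^ n) :=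
  Finset.prod_range_succ _ n

theorem summable_norm_neg_mul_pow (a : ℂ) (hq : ‖q‖ < 1) :
    Summable fun i : ℕ => ‖-(a * q ^ i)‖ := by
  simpa only [norm_neg, norm_mul, norm_pow] using
    (summable_geometric_of_lt_one (norm_nonneg q) hq).mul_left ‖a‖

theorem tendsto_qPoch (a : ℂ) (hq : ‖q‖ < 1) :
    Tendsto (qPoch a q) atTop (𝓝 (qPochInf a q)) := by
  have hmult := multipliable_one_add_of_summable (summable_norm_neg_mul_pow a hq)
  have h := hmult.tendsto_prod_tprod_nat
  simp only [← sub_eq_add_neg] at h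
  exact h

theorem qPochInf_self_ne_zero (hq : ‖q‖ < 1) : qPochInf q q ≠ 0 := by
  simp only [qPochInf, sub_eq_add_neg]
  refine tprod_one_add_ne_zero_of_summable (fun i => ?_) (summable_norm_neg_mul_pow q hq)
  rw [← sub_eq_add_neg, ← pow_succ']
  exact one_sub_pow_succ_ne_zero hq i

/-- The reciprocal `1 / (q; q)_m`, extended by `0` to negative integers `m`. With this convention
the recurrence `invQFact_sub_one` holds for all integers, and sums over `m` need no explicit
bounds. -/
noncomputable def invQFact (q : ℂ) (m : ℤ) : ℂ := if 0 ≤ m then (qPoch q q m.toNat)⁻¹ else 0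

theorem invQFact_natCast (q : ℂ) (m : ℕ) : invQFact q m = (qPoch q q m)⁻¹ := by
  simp [invQFact]

theorem invQFact_of_neg (q : ℂ) {m : ℤ} (hm : m < 0) : invQFact q m = 0 :=
  if_neg hm.not_ge

theorem invQFact_zero (q : ℂ) : invQFact q 0 = 1 := by
  simp [invQFact, qPoch]

theorem invQFact_sub_one (hq : ‖q‖ < 1) (m : ℤ) :
    invQFact q (m - 1) = (1 - q ^ m) * invQFact q m := by
  obtain hm | rfl | hm := lt_trichotomy m 0
  · rw [invQFact_of_neg q hm, invQFact_of_neg q (by omega), mul_zero]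
  · simp [invQFact_of_neg]
  obtain ⟨n, rfl⟩ : ∃ n : ℕ, m = n + 1 := ⟨(m - 1).toNat, by omega⟩
  have hne := one_sub_pow_succ_ne_zero hq n
  rw [add_sub_cancel_right, ← Nat.cast_succ, invQFact_natCast, invQFact_natCast, qPoch_succ,
    ← pow_succ', zpow_natCast, mul_inv_rev, mul_inv_cancel_left₀ hne]

theorem exists_norm_invQFact_le (hq : ‖q‖ < 1) : ∃ C : ℝ, ∀ m, ‖invQFact q m‖ ≤ C := by
  obtain ⟨C, hC⟩ :=
    ((tendsto_qPoch q hq).inv₀ (qPochInf_self_ne_zero hq)).norm.bddAbove_range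
  have hC' (m : ℕ) : ‖(qPoch q q m)⁻¹‖ ≤ C := hC ⟨m, rfl⟩
  refine ⟨C, fun m => ?_⟩
  unfold invQFact
  split_ifs
  · exact hC' _
  · exact norm_zero.trans_le ((norm_nonneg _).trans (hC' 0))

theorem tendsto_invQFact (hq : ‖q‖ < 1) (n : ℤ) :
    Tendsto (fun L : ℕ => invQFact q (L + n)) atTop (𝓝 (qPochInf q q)⁻¹) := by
  have htop : Tendsto (fun L : ℕ => ((L : ℤ) + n).toNat) atTop atTop := by
    refine tendsto_atTop.2 fun b => ?_
    filter_upwards [eventually_ge_atTop (b + n.natAbs)] with L hL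
    omega
  refine (((tendsto_qPoch q hq).inv₀ (qPochInf_self_ne_zero hq)).comp htop).congr' ?_
  filter_upwards [eventually_ge_atTop n.natAbs] with L hL
  exact (if_pos (by omega)).symm

theorem one_sub_zpow_add_mul_invQFact (hq0 : q ≠ 0) (hq : ‖q‖ < 1) (a b : ℤ) :
    (1 - q ^ (a + b)) * (invQFact q a * invQFact q b) =
      invQFact q (a - 1) * invQFact q b + q ^ a * (invQFact q a * invQFact q (b - 1)) := by
  rw [invQFact_sub_one hq, invQFact_sub_one hq, zpow_add₀ hq0]
  ring

theorem summable_mul_invQFact_mul_invQFact (q : ℂ) (c : ℤ → ℂ) (a b : ℤ) :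
    Summable fun n => c n * (invQFact q (a - n) * invQFact q (b + n)) := by
  refine summable_of_hasFiniteSupport ((Set.finite_Icc (-b) a).subset fun n hn => ?_)
  contrapose! hn
  rw [Set.mem_Icc, not_and_or] at hn
  rcases hn with hn | hn
  · simp [invQFact_of_neg q (m := b + n) (by omega)]
  · simp [invQFact_of_neg q (m := a - n) (by omega)]

end QFactorial

section QVandermonde

variable {q : ℂ}

theorem hasSum_qVandermonde (hq0 : q ≠ 0) (hq : ‖q‖ < 1) (L n m : ℤ) :
    HasSum (fun s : ℤ => q ^ ((s - n) * (s + m)) *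
        (invQFact q (L - s) * (invQFact q (s - n) * invQFact q (s + m))))
      (invQFact q (L - n) * invQFact q (L + m)) := by
  rcases lt_or_ge L n with hL | hL
  · rw [invQFact_of_neg q (sub_neg.2 hL), zero_mul]
    convert! hasSum_zero with s
    rcases lt_or_ge L s with hs | hs
    · simp [invQFact_of_neg q (m := L - s) (by omega)]
    · simp [invQFact_of_neg q (m := s - n) (by omega)]
  obtain ⟨N, rfl⟩ : ∃ N : ℕ, L = n + N := ⟨(L - n).toNat, by omega⟩
  clear hL
  induction N generalizing n with
  | zero =>
    have hzero (s : ℤ) (hs : s ≠ n) : q ^ ((s - n) * (s + m)) *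
        (invQFact q (n - s) * (invQFact q (s - n) * invQFact q (s + m))) = 0 := by
      rcases lt_or_gt_of_ne hs with hs | hs
      · simp [invQFact_of_neg q (m := s - n) (by omega)]
      · simp [invQFact_of_neg q (m := n - s) (by omega)]
    simpa [invQFact_zero] using hasSum_single n hzero
  | succ N ih =>
    have hN := one_sub_pow_succ_ne_zero hq N
    set L : ℤ := n + (N + 1 : ℕ) with hL
    have hqN : q ^ (N + 1) = q ^ (L - n) := by rw [hL, add_sub_cancel_left, zpow_natCast]
    have ih₁ := ih n
    have ih₂ := (ih (n + 1)).mul_left (q ^ (L + m))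
    rw [show n + (N : ℤ) = L - 1 by push_cast [hL]; ring] at ih₁
    rw [show n + 1 + (N : ℤ) = L by push_cast [hL]; ring] at ih₂
    rw [← hasSum_mul_left_iff hN, hqN]
    convert! ih₁.add ih₂ using 1
    · funext s
      have pascal := one_sub_zpow_add_mul_invQFact hq0 hq (L - s) (s - n)
      have hpow : q ^ (L + m) * q ^ ((s - n - 1) * (s + m)) =
          q ^ ((s - n) * (s + m)) * q ^ (L - s) := by
        rw [← zpow_add₀ hq0, ← zpow_add₀ hq0]
        ring_nf
      rw [sub_add_sub_cancel] at pascal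
      rw [sub_right_comm L 1 s, ← sub_sub s n 1]
      linear_combination (q ^ ((s - n) * (s + m)) * invQFact q (s + m)) * pascal -
        invQFact q (L - s) * invQFact q (s - n - 1) * invQFact q (s + m) * hpow
    · have h₁ := invQFact_sub_one hq (L - n)
      have h₂ := invQFact_sub_one hq (L + m)
      rw [sub_right_comm L 1 n, ← sub_sub L n 1, sub_add_eq_add_sub L 1 m, h₁, h₂]
      ring

theorem hasSum_qVandermonde_twisted (hq0 : q ≠ 0) (hq : ‖q‖ < 1) (L n : ℤ) :
    HasSum (fun s : ℤ => q ^ ((s - n) * (s + n)) * (q ^ (-s) * (1 + q ^ (L + s))) *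
        (invQFact q (L - s) * (invQFact q (s - n) * invQFact q (s + n))))
      ((q ^ n + q ^ (-n)) * (invQFact q (L - n) * invQFact q (L + n))) := by
  convert! ((hasSum_qVandermonde hq0 hq L (n + 1) n).mul_left (q ^ n)).add
    ((hasSum_qVandermonde hq0 hq L n n).mul_left (q ^ (-n) + q ^ L)) using 1
  · funext s
    have hsub := invQFact_sub_one hq (s - n)
    have hpow : q ^ n * q ^ ((s - n - 1) * (s + n)) =
        q ^ ((s - n) * (s + n)) * q ^ (-s) := by
      rw [← zpow_add₀ hq0, ← zpow_add₀ hq0]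
      ring_nf
    have hdiv : q ^ (-s) * q ^ (s - n) = q ^ (-n) := by
      rw [← zpow_add₀ hq0]
      ring_nf
    have hcancel : q ^ (-s) * q ^ (L + s) = q ^ L := by
      rw [← zpow_add₀ hq0]
      ring_nf
    rw [← sub_sub s n 1, ← mul_assoc (q ^ n), hpow, hsub]
    linear_combination (q ^ ((s - n) * (s + n)) *
      (invQFact q (L - s) * (invQFact q (s - n) * invQFact q (s + n)))) * (hcancel + hdiv)
  · have hcancel : q ^ n * q ^ (L - n) = q ^ L := by rw [← zpow_add₀ hq0, add_sub_cancel]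
    rw [← sub_sub L n 1, invQFact_sub_one hq (L - n)]
    linear_combination (invQFact q (L - n) * invQFact q (L + n)) * hcancel

end QVandermonde

section BaileyPair

variable {q : ℂ} {a : ℤ} {α : ℤ → ℂ} {β : ℕ → ℂ}

/-- `(α, β)` is a Bailey pair relative to `q ^ a`, in bilateral form:
`β_L = ∑_n α_n / ((q; q)_{L - n} (q; q)_{L + n + a})`, where `n` ranges over all integers and the
terms with `n < -L - a` or `n > L` vanish. The sequence `α` is not required to be symmetric, so it
is not determined by `β`. -/
def IsBaileyPair (q : ℂ) (a : ℤ) (α : ℤ → ℂ) (β : ℕ → ℂ) : Prop :=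
  ∀ L : ℕ, HasSum (fun n : ℤ => α n * (invQFact q (L - n) * invQFact q (L + (n + a)))) (β L)

theorem sum_range_eq_of_hasSum_int {f : ℤ → ℂ} {b : ℂ} (hf : HasSum f b) (L : ℕ)
    (hneg : ∀ s < 0, f s = 0) (hgt : ∀ s > (L : ℤ), f s = 0) :
    ∑ s ∈ range (L + 1), f s = b := by
  have hmap := Finset.sum_map (range (L + 1)) Nat.castEmbedding f
  refine hmap.symm.trans (HasSum.unique (hasSum_sum_of_ne_finset_zero
    (L := .unconditional ℤ) fun s hs => ?_) hf)
  rcases lt_or_ge s 0 with h | h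
  · exact hneg s h
  · lift s to ℕ using h
    exact hgt s (by simpa using hs)

theorem IsBaileyPair.sum {w : ℕ → ℕ → ℂ} {γ : ℤ → ℂ} (h : IsBaileyPair q a α β)
    (hw : ∀ (L : ℕ) (n : ℤ),
      ∑ s ∈ range (L + 1), w L s * (invQFact q (s - n) * invQFact q (s + (n + a))) =
        γ n * (invQFact q (L - n) * invQFact q (L + (n + a)))) :
    IsBaileyPair q a (fun n => γ n * α n) fun L => ∑ s ∈ range (L + 1), w L s * β s := by
  intro L
  convert! hasSum_sum fun s (_ : s ∈ range (L + 1)) => (h s).mul_left (w L s) using 1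
  funext n
  dsimp only
  rw [mul_comm (γ n), mul_assoc, ← hw, Finset.mul_sum]
  exact Finset.sum_congr rfl fun s _ => mul_left_comm _ _ _

theorem invQFact_mul_invQFact_of_neg (q : ℂ) (ha : a ≤ 1) (n : ℤ) {s : ℤ} (hs : s < 0) :
    invQFact q (s - n) * invQFact q (s + (n + a)) = 0 := by
  rcases lt_or_ge s n with h | h
  · rw [invQFact_of_neg q (sub_neg.2 h), zero_mul]
  · rw [invQFact_of_neg q (m := s + (n + a)) (by omega), mul_zero]

theorem IsBaileyPair.bailey_lemma (hq0 : q ≠ 0) (hq : ‖q‖ < 1) (ha : a ≤ 1)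
    (h : IsBaileyPair q a α β) :
    IsBaileyPair q a (fun n => q ^ (n ^ 2 + a * n) * α n)
      fun L => ∑ s ∈ range (L + 1), q ^ ((s : ℤ) ^ 2 + a * s) * invQFact q (L - s) * β s := by
  refine h.sum fun L n => ?_
  refine sum_range_eq_of_hasSum_int (f := fun s : ℤ => q ^ (s ^ 2 + a * s) * invQFact q (L - s) *
    (invQFact q (s - n) * invQFact q (s + (n + a)))) ?_ L (fun s hs => ?_) fun s hs => ?_
  · convert! (hasSum_qVandermonde hq0 hq L n (n + a)).mul_left (q ^ (n ^ 2 + a * n)) using 1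
    funext s
    have hpow : q ^ (n ^ 2 + a * n) * q ^ ((s - n) * (s + (n + a))) = q ^ (s ^ 2 + a * s) := by
      rw [← zpow_add₀ hq0]
      ring_nf
    rw [← hpow]
    ring
  · simp only [invQFact_mul_invQFact_of_neg q ha n hs, mul_zero]
  · simp only [invQFact_of_neg q (sub_neg.2 hs), mul_zero, zero_mul]

theorem IsBaileyPair.bailey_lemma_twisted (hq0 : q ≠ 0) (hq : ‖q‖ < 1)
    (h : IsBaileyPair q 0 α β) :
    IsBaileyPair q 0 (fun n => q ^ n ^ 2 * (q ^ n + q ^ (-n)) * α n)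
      fun L => ∑ s ∈ range (L + 1), q ^ (s : ℤ) ^ 2 *
        (q ^ (-(s : ℤ)) * (1 + q ^ ((L : ℤ) + s))) * invQFact q (L - s) * β s := by
  refine h.sum fun L n => ?_
  refine sum_range_eq_of_hasSum_int (f := fun s : ℤ => q ^ s ^ 2 * (q ^ (-s) *
    (1 + q ^ ((L : ℤ) + s))) * invQFact q (L - s) * (invQFact q (s - n) * invQFact q (s + (n + 0))))
    ?_ L (fun s hs => ?_) fun s hs => ?_
  · convert! (hasSum_qVandermonde_twisted hq0 hq L n).mul_left (q ^ n ^ 2) using 1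
    · funext s
      have hpow : q ^ n ^ 2 * q ^ ((s - n) * (s + n)) = q ^ s ^ 2 := by
        rw [← zpow_add₀ hq0]
        ring_nf
      rw [← hpow, add_zero]
      ring
    · rw [add_zero]
      ring
  · simp only [invQFact_mul_invQFact_of_neg q zero_le_one n hs, mul_zero]
  · simp only [invQFact_of_neg q (sub_neg.2 hs), mul_zero, zero_mul]

theorem isBaileyPair_one_iff_zero (hq0 : q ≠ 0) (hq : ‖q‖ < 1) :
    IsBaileyPair q 1 (fun n => (1 - q ^ (2 * n + 1)) * α n) β ↔
      IsBaileyPair q 0 (fun n => α n - q ^ (2 * n - 1) * α (n - 1)) β := by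
  refine forall_congr' fun L => ?_
  let K (n : ℤ) : ℂ := invQFact q (L - n) * invQFact q (L + n)
  have summable_K (c : ℤ → ℂ) : Summable fun n => c n * K n :=
    summable_mul_invQFact_mul_invQFact q c L L
  have kernel_one (n : ℤ) :
      (1 - q ^ (2 * n + 1)) * α n * (invQFact q (L - n) * invQFact q (L + (n + 1))) =
        α n * K n - q ^ (2 * (n + 1) - 1) * α (n + 1 - 1) * K (n + 1) := by
    have h₁ := invQFact_sub_one hq (L + (n + 1))
    have h₂ := invQFact_sub_one hq (L - n)
    have hpow : q ^ (2 * n + 1) * q ^ (L - n) = q ^ (L + (n + 1)) := by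
      rw [← zpow_add₀ hq0]
      ring_nf
    simp only [K, ← sub_sub]
    rw [h₂, show (L : ℤ) + n = L + (n + 1) - 1 by ring, h₁, add_sub_cancel_right,
      show 2 * (n + 1) - 1 = 2 * n + 1 by ring]
    linear_combination (-α n * (invQFact q (L - n) * invQFact q (L + (n + 1)))) * hpow
  have shift (f : ℤ → ℂ) (b : ℂ) : HasSum (fun n => f (n + 1)) b ↔ HasSum f b :=
    (Equiv.addRight (1 : ℤ)).hasSum_iff
  simp only [kernel_one, add_zero]
  have h₁ := (summable_K α).hasSum
  have h₂ := (summable_K fun n => q ^ (2 * n - 1) * α (n - 1)).hasSum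
  have h₂' := (shift (fun n => q ^ (2 * n - 1) * α (n - 1) * K n) _).2 h₂
  have h := h₁.sub h₂
  simp only [← sub_mul] at h
  exact ⟨fun h' => (h'.unique (h₁.sub h₂')) ▸ h, fun h' => (h'.unique h) ▸ h₁.sub h₂'⟩

theorem IsBaileyPair.tendsto {A : ℂ} (hq : ‖q‖ < 1) (h : IsBaileyPair q a α β)
    (hα : HasSum α A) :
    Tendsto β atTop (𝓝 (A * ((qPochInf q q)⁻¹ * (qPochInf q q)⁻¹))) := by
  obtain ⟨C, hC⟩ := exists_norm_invQFact_le hq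
  have hβ : β = fun L : ℕ => ∑' n, α n * (invQFact q (L - n) * invQFact q (L + (n + a))) :=
    funext fun L => (h L).tsum_eq.symm
  rw [hβ, ← hα.tsum_eq, ← tsum_mul_right]
  refine tendsto_tsum_of_dominated_convergence (bound := fun n => ‖α n‖ * (C * C))
    (hα.summable.norm.mul_right _) (fun n => ?_) (Eventually.of_forall fun L n => ?_)
  · refine Tendsto.const_mul _ (Tendsto.mul ?_ (tendsto_invQFact hq (n + a)))
    simpa only [sub_eq_add_neg] using tendsto_invQFact hq (-n)
  · rw [norm_mul, norm_mul]
    gcongr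
    · exact (norm_nonneg _).trans (hC 0)
    · exact hC _
    · exact hC _

end BaileyPair

section InitialPair

variable {q : ℂ}

theorem neg_one_zpow_neg {K : Type*} [DivisionRing K] (n : ℤ) : (-1 : K) ^ (-n) = (-1) ^ n := by
  rw [zpow_neg, ← inv_zpow, inv_neg_one]

theorem neg_one_zpow_add_one {K : Type*} [DivisionRing K] (n : ℤ) :
    (-1 : K) ^ (n + 1) = -(-1) ^ n := by
  rw [zpow_add_one₀ (neg_ne_zero.2 one_ne_zero), mul_neg_one]

/-- The alternating sum `∑_n (-1)^n q^(n² + c n) / ((q; q)_{a - n} (q; q)_{b + n})` over all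
integers `n`, which is the `β` of a Bailey pair when `a = b`. Varying `a` and `b` separately is
what makes its recurrences close up. -/
noncomputable def altGaussSum (q : ℂ) (c a b : ℤ) : ℂ :=
  ∑' n : ℤ, (-1) ^ n * q ^ (n ^ 2 + c * n) * (invQFact q (a - n) * invQFact q (b + n))

theorem hasSum_altGaussSum (q : ℂ) (c a b : ℤ) :
    HasSum (fun n : ℤ => (-1) ^ n * q ^ (n ^ 2 + c * n) *
      (invQFact q (a - n) * invQFact q (b + n))) (altGaussSum q c a b) :=
  (summable_mul_invQFact_mul_invQFact q _ a b).hasSum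

theorem altGaussSum_neg (q : ℂ) (c a b : ℤ) : altGaussSum q (-c) b a = altGaussSum q c a b := by
  unfold altGaussSum
  rw [← (Equiv.neg ℤ).tsum_eq]
  refine tsum_congr fun n => ?_
  rw [Equiv.neg_apply, neg_one_zpow_neg, sub_neg_eq_add, ← sub_eq_add_neg, neg_sq, neg_mul_neg,
    mul_comm (invQFact q (b + n))]

theorem altGaussSum_shift (hq0 : q ≠ 0) (c a b : ℤ) :
    altGaussSum q c a b = -q ^ (1 + c) * altGaussSum q (c + 2) (a - 1) (b + 1) := by
  unfold altGaussSum
  rw [← (Equiv.addRight (1 : ℤ)).tsum_eq, ← tsum_mul_left]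
  refine tsum_congr fun n => ?_
  have hpow : q ^ ((n + 1) ^ 2 + c * (n + 1)) = q ^ (1 + c) * q ^ (n ^ 2 + (c + 2) * n) := by
    rw [← zpow_add₀ hq0]
    ring_nf
  rw [Equiv.coe_addRight, neg_one_zpow_add_one, hpow, sub_right_comm a 1 n, ← sub_sub,
    sub_right_comm a n 1, add_right_comm b 1 n, ← add_assoc]
  ring

theorem altGaussSum_sub_one_left (hq0 : q ≠ 0) (hq : ‖q‖ < 1) (c a b : ℤ) :
    altGaussSum q c (a - 1) b = altGaussSum q c a b - q ^ a * altGaussSum q (c - 1) a b := by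
  refine (hasSum_altGaussSum q c (a - 1) b).unique ?_
  convert! (hasSum_altGaussSum q c a b).sub
    ((hasSum_altGaussSum q (c - 1) a b).mul_left (q ^ a)) using 1
  funext n
  have hpow : q ^ (n ^ 2 + c * n) * q ^ (a - n) = q ^ a * q ^ (n ^ 2 + (c - 1) * n) := by
    rw [← zpow_add₀ hq0, ← zpow_add₀ hq0]
    ring_nf
  rw [sub_right_comm, invQFact_sub_one hq]
  linear_combination (-(-1) ^ n * (invQFact q (a - n) * invQFact q (b + n))) * hpow

theorem altGaussSum_sub_one_right (hq0 : q ≠ 0) (hq : ‖q‖ < 1) (c a b : ℤ) :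
    altGaussSum q c a (b - 1) = altGaussSum q c a b - q ^ b * altGaussSum q (c + 1) a b := by
  rw [← altGaussSum_neg q c, altGaussSum_sub_one_left hq0 hq, altGaussSum_neg,
    ← altGaussSum_neg q (c + 1), neg_add']

theorem altGaussSum_neg_one_sub_one (hq0 : q ≠ 0) (L : ℤ) :
    altGaussSum q (-1) L (L - 1) = 0 := by
  refine self_eq_neg.1 ?_
  conv_lhs => rw [altGaussSum_shift hq0, ← altGaussSum_neg]
  norm_num

theorem altGaussSum_neg_one_self (hq0 : q ≠ 0) (hq : ‖q‖ < 1) (L : ℤ) :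
    altGaussSum q (-1) L L = q ^ L * altGaussSum q 0 L L := by
  have h := altGaussSum_sub_one_right hq0 hq (-1) L L
  rw [altGaussSum_neg_one_sub_one hq0, neg_add_cancel] at h
  exact sub_eq_zero.1 h.symm

theorem altGaussSum_zero_sub_one_sub_one (hq0 : q ≠ 0) (hq : ‖q‖ < 1) (L : ℤ) :
    altGaussSum q 0 (L - 1) (L - 1) = (1 - q ^ (2 * L)) * altGaussSum q 0 L L := by
  rw [altGaussSum_sub_one_left hq0 hq, zero_sub, altGaussSum_neg_one_sub_one hq0, mul_zero,
    sub_zero, altGaussSum_sub_one_right hq0 hq, zero_add, ← altGaussSum_neg q 1,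
    altGaussSum_neg_one_self hq0 hq, two_mul, zpow_add₀ hq0]
  ring

theorem altGaussSum_zero_self (hq0 : q ≠ 0) (hq : ‖q‖ < 1) (L : ℕ) :
    altGaussSum q 0 L L = (qPoch (q ^ 2) (q ^ 2) L)⁻¹ := by
  induction L with
  | zero =>
    refine (hasSum_altGaussSum q 0 0 0).unique ?_
    have hzero (n : ℤ) (hn : n ≠ 0) : (-1 : ℂ) ^ n * q ^ (n ^ 2 + 0 * n) *
        (invQFact q (0 - n) * invQFact q (0 + n)) = 0 := by
      rcases lt_or_gt_of_ne hn with hn | hn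
      · simp [invQFact_of_neg q hn]
      · simp [invQFact_of_neg q (neg_lt_zero.2 hn)]
    simpa [invQFact_zero, qPoch] using hasSum_single 0 hzero
  | succ L ih =>
    have hne := one_sub_pow_succ_ne_zero (norm_sq_lt_one hq) L
    have hrec := altGaussSum_zero_sub_one_sub_one hq0 hq (L + 1)
    have hpow : q ^ (2 * ((L : ℤ) + 1)) = (q ^ 2) ^ (L + 1) := by
      rw [zpow_mul, ← Nat.cast_succ, zpow_natCast, zpow_ofNat]
    rw [add_sub_cancel_right, ih, hpow] at hrec
    rw [qPoch_succ, ← pow_succ', mul_inv_rev, Nat.cast_succ, hrec, inv_mul_cancel_left₀ hne]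

theorem isBaileyPair_zero_alternating (hq0 : q ≠ 0) (hq : ‖q‖ < 1) :
    IsBaileyPair q 0 (fun n => (-1) ^ n * q ^ (n ^ 2 - n))
      fun L => q ^ L / qPoch (q ^ 2) (q ^ 2) L := by
  intro L
  have h := hasSum_altGaussSum q (-1) L L
  rw [altGaussSum_neg_one_self hq0 hq, altGaussSum_zero_self hq0 hq, zpow_natCast,
    ← div_eq_mul_inv] at h
  simpa only [neg_one_mul, ← sub_eq_add_neg, add_zero] using h

end InitialPair

section TripleProduct

variable {t z : ℂ}

theorem summable_nat_zpow_mul_zpow_sq_sub (ht0 : t ≠ 0) (ht : ‖t‖ < 1) (hz : z ≠ 0) :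
    Summable fun n : ℕ => z ^ (n : ℤ) * t ^ ((n : ℤ) ^ 2 - n) := by
  have hne (n : ℤ) : z ^ n * t ^ (n ^ 2 - n) ≠ 0 :=
    mul_ne_zero (zpow_ne_zero _ hz) (zpow_ne_zero _ ht0)
  have hstep (n : ℕ) : z ^ ((n + 1 : ℕ) : ℤ) * t ^ (((n + 1 : ℕ) : ℤ) ^ 2 - (n + 1 : ℕ)) =
      z ^ (n : ℤ) * t ^ ((n : ℤ) ^ 2 - n) * (z * (t ^ 2) ^ n) := by
    have hexp : ((n : ℤ) + 1) ^ 2 - (n + 1) = n ^ 2 - n + 2 * n := by ring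
    rw [Nat.cast_succ, hexp, zpow_add_one₀ hz, zpow_add₀ ht0, zpow_mul, zpow_natCast (t ^ _),
      zpow_ofNat]
    ring
  have hratio (n : ℕ) : ‖z ^ ((n + 1 : ℕ) : ℤ) * t ^ (((n + 1 : ℕ) : ℤ) ^ 2 - (n + 1 : ℕ))‖ /
      ‖z ^ (n : ℤ) * t ^ ((n : ℤ) ^ 2 - n)‖ = ‖z‖ * ‖t ^ 2‖ ^ n := by
    rw [hstep, norm_mul, mul_div_cancel_left₀ _ (norm_ne_zero_iff.2 (hne n)), norm_mul, norm_pow]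
  refine summable_of_ratio_test_tendsto_lt_one zero_lt_one (.of_forall fun n : ℕ => hne n) ?_
  simp only [hratio]
  simpa using (tendsto_pow_atTop_nhds_zero_of_lt_one (norm_nonneg _)
    (norm_sq_lt_one ht)).const_mul ‖z‖

theorem zpow_neg_mul_zpow_sq_sub_neg (ht0 : t ≠ 0) (z : ℂ) (n : ℤ) :
    z ^ (-n) * t ^ ((-n) ^ 2 - -n) = (t ^ 2 / z) ^ n * t ^ (n ^ 2 - n) := by
  have hexp : (-n) ^ 2 - -n = 2 * n + (n ^ 2 - n) := by ring
  rw [div_zpow, hexp, zpow_add₀ ht0, zpow_mul, zpow_ofNat, zpow_neg]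
  ring

theorem summable_zpow_mul_zpow_sq_sub (ht0 : t ≠ 0) (ht : ‖t‖ < 1) (hz : z ≠ 0) :
    Summable fun n : ℤ => z ^ n * t ^ (n ^ 2 - n) := by
  refine Summable.of_nat_of_neg (summable_nat_zpow_mul_zpow_sq_sub ht0 ht hz) ?_
  simp only [zpow_neg_mul_zpow_sq_sub_neg ht0]
  exact summable_nat_zpow_mul_zpow_sq_sub ht0 ht (div_ne_zero (pow_ne_zero 2 ht0) hz)

/-- The `n`-th term of the finite form of the Jacobi triple product, with base `t ^ 2`, so that the
binomial exponent `n (n - 1) / 2` becomes the integral exponent `n ^ 2 - n` of `t`. -/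
noncomputable def tripleTerm (t z : ℂ) (a b n : ℤ) : ℂ :=
  (-1) ^ n * (z ^ n * t ^ (n ^ 2 - n)) * (invQFact (t ^ 2) (a - n) * invQFact (t ^ 2) (b + n))

theorem tripleTerm_neg (ht0 : t ≠ 0) (z : ℂ) (a b n : ℤ) :
    tripleTerm t z a b (-n) = tripleTerm t (t ^ 2 / z) b a n := by
  rw [tripleTerm, tripleTerm, neg_one_zpow_neg, zpow_neg_mul_zpow_sq_sub_neg ht0, sub_neg_eq_add,
    ← sub_eq_add_neg, mul_comm (invQFact _ (a + n))]

theorem one_sub_mul_tripleTerm_add_one (ht0 : t ≠ 0) (ht : ‖t‖ < 1) (hz : z ≠ 0) (a b n : ℤ) :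
    (1 - (t ^ 2) ^ (a + b + 1)) * tripleTerm t z (a + 1) b n =
      tripleTerm t z a b n - z * (t ^ 2) ^ a * tripleTerm t z a b (n - 1) := by
  have pascal := one_sub_zpow_add_mul_invQFact (pow_ne_zero 2 ht0) (norm_sq_lt_one ht)
    (a + 1 - n) (b + n)
  have hsign := neg_one_zpow_add_one (K := ℂ) (n - 1)
  have hzpow : z * z ^ (n - 1) = z ^ n := by rw [← zpow_one_add₀ hz, add_sub_cancel]
  have htpow : (t ^ 2) ^ a * t ^ ((n - 1) ^ 2 - (n - 1)) =
      t ^ (n ^ 2 - n) * (t ^ 2) ^ (a + 1 - n) := by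
    rw [← zpow_ofNat t 2, ← zpow_mul, ← zpow_mul, ← zpow_add₀ ht0, ← zpow_add₀ ht0]
    ring_nf
  rw [show a + 1 - n + (b + n) = a + b + 1 by ring, show a + 1 - n - 1 = a - n by ring] at pascal
  rw [sub_add_cancel] at hsign
  rw [tripleTerm, tripleTerm, tripleTerm, mul_left_comm, pascal, hsign, ← hzpow,
    show a - (n - 1) = a + 1 - n by ring, ← add_sub_assoc]
  linear_combination ((-1) ^ (n - 1) * z * z ^ (n - 1) *
    (invQFact (t ^ 2) (a + 1 - n) * invQFact (t ^ 2) (b + n - 1))) * htpow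

theorem hasSum_tripleTerm_of_zero_left (ht0 : t ≠ 0) (ht : ‖t‖ < 1) (hz : z ≠ 0) {b : ℕ} {B : ℂ}
    (h : HasSum (tripleTerm t z 0 b) (B * invQFact (t ^ 2) b)) (a : ℕ) :
    HasSum (tripleTerm t z a b) (qPoch z (t ^ 2) a * B * invQFact (t ^ 2) (a + b)) := by
  induction a with
  | zero => simpa [qPoch] using h
  | succ a ih =>
    have hne := one_sub_pow_succ_ne_zero (norm_sq_lt_one ht) (a + b)
    have hpow : (t ^ 2) ^ (a + b + 1) = (t ^ 2) ^ ((a : ℤ) + b + 1) := by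
      rw [← zpow_natCast]
      push_cast
      rfl
    have hrec := invQFact_sub_one (norm_sq_lt_one ht) (a + b + 1)
    have hshift := ((Equiv.subRight (1 : ℤ)).hasSum_iff.2 ih).mul_left (z * (t ^ 2) ^ (a : ℤ))
    rw [← hasSum_mul_left_iff hne, hpow]
    convert! ih.sub hshift using 1
    · exact funext fun n => one_sub_mul_tripleTerm_add_one ht0 ht hz a b n
    · rw [add_sub_cancel_right] at hrec
      rw [qPoch_succ, hrec, Nat.cast_succ, add_right_comm (a : ℤ) 1 b, zpow_natCast _ a]
      ring

theorem hasSum_tripleTerm (ht0 : t ≠ 0) (ht : ‖t‖ < 1) (hz : z ≠ 0) (a b : ℕ) :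
    HasSum (tripleTerm t z a b)
      (qPoch z (t ^ 2) a * qPoch (t ^ 2 / z) (t ^ 2) b * invQFact (t ^ 2) (a + b)) := by
  refine hasSum_tripleTerm_of_zero_left ht0 ht hz ?_ a
  have hz' : t ^ 2 / z ≠ 0 := div_ne_zero (pow_ne_zero 2 ht0) hz
  have hzero (n : ℤ) (hn : n ≠ 0) : tripleTerm t (t ^ 2 / z) 0 (0 : ℕ) n = 0 := by
    rcases lt_or_gt_of_ne hn with hn | hn
    · simp [tripleTerm, invQFact_of_neg _ hn]
    · simp [tripleTerm, invQFact_of_neg _ (neg_lt_zero.2 hn)]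
  have hbase : HasSum (tripleTerm t (t ^ 2 / z) 0 (0 : ℕ)) (1 * invQFact (t ^ 2) (0 : ℕ)) := by
    simpa [tripleTerm, invQFact_zero] using hasSum_single 0 hzero
  have h := hasSum_tripleTerm_of_zero_left ht0 ht hz' hbase b
  rw [mul_one, Nat.cast_zero, add_zero] at h
  refine (Equiv.neg ℤ).hasSum_iff.1 ?_
  convert! h using 1
  exact funext fun n => tripleTerm_neg ht0 z 0 b n

theorem hasSum_tripleProduct (ht0 : t ≠ 0) (ht : ‖t‖ < 1) (hz : z ≠ 0) :
    HasSum (fun n : ℤ => (-1) ^ n * (z ^ n * t ^ (n ^ 2 - n)))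
      (qPochInf₃ (t ^ 2) z (t ^ 2 / z) (t ^ 2)) := by
  have ht2 := norm_sq_lt_one ht
  have hne := qPochInf_self_ne_zero ht2
  have hsummable : Summable fun n : ℤ => (-1) ^ n * (z ^ n * t ^ (n ^ 2 - n)) := by
    refine .of_norm ?_
    simpa only [norm_mul, norm_zpow, norm_neg, norm_one, one_zpow, one_mul] using
      (summable_zpow_mul_zpow_sq_sub ht0 ht hz).norm
  have hpair : IsBaileyPair (t ^ 2) 0 (fun n => (-1) ^ n * (z ^ n * t ^ (n ^ 2 - n))) fun L =>
      qPoch z (t ^ 2) L * qPoch (t ^ 2 / z) (t ^ 2) L * (qPoch (t ^ 2) (t ^ 2) (L + L))⁻¹ := by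
    intro L
    have h := hasSum_tripleTerm ht0 ht hz L L
    rw [← Nat.cast_add, invQFact_natCast] at h
    simp only [add_zero]
    exact h
  have hlim := ((tendsto_qPoch z ht2).mul (tendsto_qPoch (t ^ 2 / z) ht2)).mul
    (((tendsto_qPoch (t ^ 2) ht2).inv₀ hne).comp
      (tendsto_atTop_mono (fun L => Nat.le_add_left L L) tendsto_id))
  have hunique := tendsto_nhds_unique (hpair.tendsto ht2 hsummable.hasSum) hlim
  convert! hsummable.hasSum using 1
  have hinv := inv_ne_zero hne
  refine mul_right_cancel₀ (mul_ne_zero hinv hinv) (Eq.trans ?_ hunique.symm)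
  rw [qPochInf₃]
  field_simp

end TripleProduct

section Theta

variable {q : ℂ} {K : ℕ}

theorem hasSum_theta (hq0 : q ≠ 0) (hq : ‖q‖ < 1) (hK : K ≠ 0) (b : ℤ) :
    HasSum (fun n : ℤ => (-1) ^ n * q ^ (K * n ^ 2 + b * n))
      (qPochInf₃ (q ^ (2 * K)) (q ^ (K + b)) (q ^ (K - b)) (q ^ (2 * K))) := by
  have ht : ‖q ^ K‖ < 1 := by
    rw [norm_pow]
    exact pow_lt_one₀ (norm_nonneg q) hq hK
  have hsq : (q ^ K) ^ 2 = q ^ (2 * K) := by rw [← pow_mul, mul_comm]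
  have hdiv : (q ^ K) ^ 2 / q ^ (K + b) = q ^ (K - b) := by
    rw [← zpow_natCast q K, ← zpow_ofNat, ← zpow_mul, ← zpow_sub₀ hq0]
    ring_nf
  have h := hasSum_tripleProduct (pow_ne_zero K hq0) ht (zpow_ne_zero (K + b) hq0)
  rw [hdiv, hsq] at h
  convert! h using 1
  funext n
  rw [← zpow_natCast q K, ← zpow_mul, ← zpow_mul, ← zpow_add₀ hq0]
  ring_nf

theorem hasSum_theta_mul_pow (hq0 : q ≠ 0) (hq : ‖q‖ < 1) (hK : K ≠ 0) (b : ℤ) (j : ℕ) :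
    HasSum (fun n : ℤ => (-1) ^ n * q ^ (K * n ^ 2 + b * n) * (q ^ n + q ^ (-n)) ^ j)
      (∑ s ∈ range (j + 1), (j.choose s : ℂ) *
        qPochInf₃ (q ^ (2 * K)) (q ^ (K + (b + j - 2 * s))) (q ^ (K - (b + j - 2 * s)))
          (q ^ (2 * K))) := by
  convert! hasSum_sum fun s (_ : s ∈ range (j + 1)) =>
    (hasSum_theta hq0 hq hK (b + j - 2 * s)).mul_left (j.choose s : ℂ) using 1
  funext n
  rw [add_comm (q ^ n), add_pow, Finset.mul_sum]
  refine Finset.sum_congr rfl fun s hs => ?_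
  have hsj : s ≤ j := Nat.lt_succ_iff.1 (mem_range.1 hs)
  have hpow : q ^ (K * n ^ 2 + b * n) * ((q ^ (-n)) ^ s * (q ^ n) ^ (j - s)) =
      q ^ (K * n ^ 2 + (b + j - 2 * s) * n) := by
    rw [← zpow_natCast _ s, ← zpow_natCast _ (j - s), ← zpow_mul, ← zpow_mul, ← zpow_add₀ hq0,
      ← zpow_add₀ hq0, Nat.cast_sub hsj]
    ring_nf
  rw [← hpow]
  ring

/-- The sequence that the summations with linear exponent, `r` in number, produce from the initial
Bailey pair, expressed relative to `1`. -/
noncomputable def kurAlpha (q : ℂ) (r : ℕ) (n : ℤ) : ℂ :=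
  1 / (1 + q) * ((-1) ^ n *
    (q ^ ((r + 1) * n ^ 2 + (r - 1) * n) + q * q ^ ((r + 1) * n ^ 2 - (r + 1) * n)))

theorem hasSum_kurAlpha (hq0 : q ≠ 0) (hq : ‖q‖ < 1) (k r j : ℕ) :
    HasSum (fun n : ℤ => q ^ (((k : ℤ) - r) * n ^ 2) * (q ^ n + q ^ (-n)) ^ j * kurAlpha q r n)
      (kurProductSide k r j q * qPochInf q q) := by
  have hne := qPochInf_self_ne_zero hq
  have h₁ := (Equiv.neg ℤ).hasSum_iff.2 (hasSum_theta_mul_pow hq0 hq k.succ_ne_zero (1 - r) j)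
  have h₂ := hasSum_theta_mul_pow hq0 hq k.succ_ne_zero (-(r + 1)) j
  convert! (h₁.add (h₂.mul_left q)).mul_left (1 / (1 + q)) using 1
  · funext n
    have hpow₁ : q ^ (((k : ℤ) - r) * n ^ 2) * q ^ (((r : ℤ) + 1) * n ^ 2 + (r - 1) * n) =
        q ^ (((k + 1 : ℕ) : ℤ) * (-n) ^ 2 + (1 - r) * -n) := by
      rw [← zpow_add₀ hq0]
      push_cast
      ring_nf
    have hpow₂ : q ^ (((k : ℤ) - r) * n ^ 2) * q ^ (((r : ℤ) + 1) * n ^ 2 - (r + 1) * n) =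
        q ^ (((k + 1 : ℕ) : ℤ) * n ^ 2 + -(r + 1) * n) := by
      rw [← zpow_add₀ hq0]
      push_cast
      ring_nf
    simp only [Function.comp_apply, Equiv.neg_apply]
    rw [← hpow₁, ← hpow₂, kurAlpha, neg_one_zpow_neg, neg_neg, add_comm (q ^ (-n))]
    ring
  · rw [kurProductSide, mul_assoc, Finset.mul_sum, ← Finset.sum_add_distrib, Finset.sum_mul]
    refine congrArg _ (Finset.sum_congr rfl fun s _ => ?_)
    rw [mul_assoc, add_mul, div_mul_cancel₀ _ hne, mul_assoc q, div_mul_cancel₀ _ hne,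
      Nat.succ_eq_add_one]
    push_cast
    ring_nf

end Theta

section Chain

theorem summable_prod_pi {b : ℕ → ℝ} (hb0 : ∀ s, 0 ≤ b s) (hb : Summable b) (t : ℕ) :
    Summable fun s : Fin t → ℕ => ∏ i, b (s i) := by
  induction t with
  | zero => exact (hasSum_fintype _).summable
  | succ t ih =>
    rw [← (Fin.consEquiv fun _ : Fin (t + 1) => ℕ).summable_iff]
    refine (hb.mul_of_nonneg ih hb0 fun s => Finset.prod_nonneg fun i _ => hb0 _).congr fun x => ?_
    simp [Fin.consEquiv, Fin.prod_univ_succ]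

/-- The chain `L, s_1, …, s_t` of natural numbers with head `L` at position `0`, continued by
zeros. -/
def chainEntry {t : ℕ} (L : ℕ) (s : Fin t → ℕ) : ℕ → ℕ
  | 0 => L
  | m + 1 => if h : m < t then s ⟨m, h⟩ else 0

/-- The weight `w (i + 1) L s_1 * w (i + 2) s_1 s_2 * ⋯ * w (i + t) s_(t-1) s_t * g s_t` of the
chain `L, s_1, …, s_t`. -/
def chainTerm {R : Type*} [CommSemiring R] (w : ℕ → ℕ → ℕ → R) (g : ℕ → R) {t : ℕ} (i L : ℕ)
    (s : Fin t → ℕ) : R :=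
  (∏ m ∈ range t, w (i + m + 1) (chainEntry L s m) (chainEntry L s (m + 1))) *
    g (chainEntry L s t)

/-- The sum of the weights `chainTerm w g i L s` of the weakly decreasing chains `L, s_1, …, s_t`,
as an iterated finite sum. -/
def chainSum {R : Type*} [CommSemiring R] (w : ℕ → ℕ → ℕ → R) (g : ℕ → R) : ℕ → ℕ → ℕ → R
  | 0, _, L => g L
  | t + 1, i, L => ∑ s ∈ range (L + 1), w (i + 1) L s * chainSum w g t (i + 1) s

theorem chainEntry_tail {t : ℕ} (L : ℕ) (s : Fin (t + 1) → ℕ) (m : ℕ) :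
    chainEntry (s 0) (Fin.tail s) m = chainEntry L s (m + 1) := by
  cases m with
  | zero => simp [chainEntry]
  | succ m => simp [chainEntry, Fin.tail]

theorem chainTerm_succ {R : Type*} [CommSemiring R] (w : ℕ → ℕ → ℕ → R) (g : ℕ → R) {t : ℕ}
    (i L : ℕ) (s : Fin (t + 1) → ℕ) :
    chainTerm w g i L s = w (i + 1) L (s 0) * chainTerm w g (i + 1) (s 0) (Fin.tail s) := by
  simp only [chainTerm, chainEntry_tail L]
  rw [prod_range_succ', ← chainEntry_tail L s 0]
  simp only [chainEntry, ← add_assoc, add_right_comm i _ 1, add_zero]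
  ring

variable {𝕜 : Type*} [NormedField 𝕜] {w : ℕ → ℕ → ℕ → 𝕜} {g : ℕ → 𝕜} {b : ℕ → ℝ} {C : ℝ} {t : ℕ}

theorem norm_chainTerm_le (hw : ∀ i L s, ‖w i L s‖ ≤ b s) (hg : ∀ s, ‖g s‖ ≤ C) (i L : ℕ)
    (s : Fin t → ℕ) : ‖chainTerm w g i L s‖ ≤ (∏ m, b (s m)) * C := by
  induction t generalizing i L with
  | zero => simpa [chainTerm, chainEntry] using hg L
  | succ t ih =>
    rw [chainTerm_succ, norm_mul, Fin.prod_univ_succ, mul_assoc]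
    exact mul_le_mul (hw _ _ _) (ih _ _ _) (norm_nonneg _) ((norm_nonneg _).trans (hw 0 0 _))

theorem summable_chainTerm [CompleteSpace 𝕜] (hb : Summable b) (hw : ∀ i L s, ‖w i L s‖ ≤ b s)
    (hg : ∀ s, ‖g s‖ ≤ C) (i L : ℕ) :
    Summable (chainTerm w g i L : (Fin t → ℕ) → 𝕜) :=
  .of_norm_bounded ((summable_prod_pi (fun s => (norm_nonneg _).trans (hw 0 0 s)) hb t).mul_right C)
    (norm_chainTerm_le hw hg i L)

theorem hasSum_chainTerm [CompleteSpace 𝕜] (hb : Summable b) (hw : ∀ i L s, ‖w i L s‖ ≤ b s)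
    (hg : ∀ s, ‖g s‖ ≤ C) (hzero : ∀ i L s, L < s → w i L s = 0) (i L : ℕ) :
    HasSum (chainTerm w g i L : (Fin t → ℕ) → 𝕜) (chainSum w g t i L) := by
  induction t generalizing i L with
  | zero =>
    convert! hasSum_unique (chainTerm w g i L : (Fin 0 → ℕ) → 𝕜) using 1
    simp [chainTerm, chainEntry, chainSum]
  | succ t ih =>
    have hsum := (summable_chainTerm (t := t + 1) hb hw hg i L).hasSum
    have hcons := (Fin.consEquiv fun _ : Fin (t + 1) => ℕ).hasSum_iff.2 hsum
    have hiterated : HasSum (fun s => w (i + 1) L s * chainSum w g t (i + 1) s) _ :=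
      hcons.prod_fiberwise fun s => by
        simpa [Function.comp_def, chainTerm_succ, Fin.consEquiv] using
          (ih (i + 1) s).mul_left (w (i + 1) L s)
    have hfinite : HasSum (fun s => w (i + 1) L s * chainSum w g t (i + 1) s)
        (chainSum w g (t + 1) i L) :=
      hasSum_sum_of_ne_finset_zero fun s hs => by
        rw [hzero _ L s (by simpa using hs), zero_mul]
    exact hiterated.unique hfinite ▸ hsum

theorem hasSum_of_tendsto_of_dominated {γ ι G : Type*} [NormedAddCommGroup G] [CompleteSpace G]
    {l : Filter γ} [l.NeBot] {f : γ → ι → G} {f' : ι → G} {bound : ι → ℝ} {a : γ → G} {a' : G}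
    (hbound : Summable bound) (hle : ∀ L x, ‖f L x‖ ≤ bound x)
    (hf : ∀ x, Tendsto (fun L => f L x) l (𝓝 (f' x))) (hsum : ∀ L, HasSum (f L) (a L))
    (ha : Tendsto a l (𝓝 a')) : HasSum f' a' := by
  have hf' : Summable f' :=
    .of_norm_bounded hbound fun x => le_of_tendsto' (hf x).norm fun L => hle L x
  have hlim := tendsto_tsum_of_dominated_convergence hbound hf (.of_forall hle)
  simp only [(hsum _).tsum_eq] at hlim
  exact tendsto_nhds_unique hlim ha ▸ hf'.hasSum

end Chain

section Multisum

variable {q : ℂ} {k r : ℕ} {I : Finset ℕ}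

/-- The factor of the multisum that joins `s_(i-1) = L` to `s_i = s`, for the set `I` of positions
carrying an extra factor. For `i = 1` the number `L` is auxiliary: the factors
`(1 + q^(L + s_1)) / (q)_(L - s_1)` disappear as `L → ∞`. -/
noncomputable def kurStep (q : ℂ) (k r : ℕ) (I : Finset ℕ) (i L s : ℕ) : ℂ :=
  q ^ s ^ 2 * (if k - r < i then q ^ s else 1) *
    (if i ∈ I then q ^ (-(s : ℤ)) * (1 + q ^ (L + s)) else 1) * invQFact q (L - s)

/-- The factor of the multisum that depends on `s_k` alone, apart from those in `kurStep`. -/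
noncomputable def kurLast (q : ℂ) (s : ℕ) : ℂ := q ^ s / qPoch (q ^ 2) (q ^ 2) s

theorem norm_one_add_pow_le_two (hq : ‖q‖ < 1) (n : ℕ) : ‖1 + q ^ n‖ ≤ 2 := by
  refine (norm_add_le _ _).trans ?_
  rw [norm_one, norm_pow]
  linarith [pow_le_one₀ (n := n) (norm_nonneg q) hq.le]

theorem norm_kurStep_le (hq0 : q ≠ 0) (hq : ‖q‖ < 1) {C : ℝ} (hC : ∀ m, ‖invQFact q m‖ ≤ C)
    (i L s : ℕ) : ‖kurStep q k r I i L s‖ ≤ ‖q ^ ((s : ℤ) ^ 2 - s)‖ * (2 * C) := by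
  have hsq : ‖q ^ ((s : ℤ) ^ 2 - s)‖ = ‖q ^ s ^ 2‖ * ‖q ^ (-(s : ℤ))‖ := by
    rw [← norm_mul, ← zpow_natCast, ← zpow_add₀ hq0, Nat.cast_pow, sub_eq_add_neg]
  have hlinear : ‖(if k - r < i then q ^ s else 1 : ℂ)‖ ≤ 1 := by
    split_ifs
    · rw [norm_pow]
      exact pow_le_one₀ (norm_nonneg q) hq.le
    · exact norm_one.le
  have hinv : 1 ≤ ‖q ^ (-(s : ℤ))‖ := by
    rw [zpow_neg, zpow_natCast, norm_inv, norm_pow]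
    exact (one_le_inv₀ (pow_pos (norm_pos_iff.2 hq0) s)).2 (pow_le_one₀ (norm_nonneg q) hq.le)
  have hextra : ‖(if i ∈ I then q ^ (-(s : ℤ)) * (1 + q ^ (L + s)) else 1 : ℂ)‖ ≤
      ‖q ^ (-(s : ℤ))‖ * 2 := by
    split_ifs
    · rw [norm_mul]
      exact mul_le_mul_of_nonneg_left (norm_one_add_pow_le_two hq _) (norm_nonneg _)
    · rw [norm_one]
      linarith
  calc ‖kurStep q k r I i L s‖ ≤ ‖q ^ s ^ 2‖ * 1 * (‖q ^ (-(s : ℤ))‖ * 2) * C := by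
        rw [kurStep, norm_mul, norm_mul, norm_mul]
        gcongr
        exact hC _
    _ = ‖q ^ ((s : ℤ) ^ 2 - s)‖ * (2 * C) := by
        rw [hsq]
        ring

theorem exists_norm_kurLast_le (hq : ‖q‖ < 1) : ∃ C : ℝ, ∀ s, ‖kurLast q s‖ ≤ C := by
  have hq2 : ‖q ^ 2‖ < 1 := norm_sq_lt_one hq
  obtain ⟨C, hC⟩ := exists_norm_invQFact_le hq2
  refine ⟨C, fun s => ?_⟩
  rw [kurLast, div_eq_mul_inv, ← invQFact_natCast, norm_mul, norm_pow]
  exact (mul_le_of_le_one_left (norm_nonneg _) (pow_le_one₀ (norm_nonneg q) hq.le)).trans (hC s)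

theorem kurStep_eq_zero {L s : ℕ} (i : ℕ) (h : L < s) : kurStep q k r I i L s = 0 := by
  rw [kurStep, invQFact_of_neg q (by omega), mul_zero]

theorem kurAlpha_zero (hq : ‖q‖ < 1) (n : ℤ) : kurAlpha q 0 n = (-1) ^ n * q ^ (n ^ 2 - n) := by
  have hne := one_add_ne_zero_of_norm_lt_one hq
  simp only [kurAlpha, Nat.cast_zero, zero_add, zero_sub, one_mul, neg_one_mul, ← sub_eq_add_neg]
  field_simp

theorem sub_zpow_mul_shift_eq_kurAlpha (hq0 : q ≠ 0) (t : ℕ) (n : ℤ) :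
    (-1) ^ n * q ^ ((t + 1) * n ^ 2 + (t - 1) * n) / (1 + q) - q ^ (2 * n - 1) *
        ((-1) ^ (n - 1) * q ^ ((t + 1) * (n - 1) ^ 2 + (t - 1) * (n - 1)) / (1 + q)) =
      kurAlpha q t n := by
  have hsign : (-1 : ℂ) ^ n = -(-1) ^ (n - 1) := by
    rw [← neg_one_zpow_add_one, sub_add_cancel]
  have hpow : q ^ (2 * n - 1) * q ^ (((t : ℤ) + 1) * (n - 1) ^ 2 + (t - 1) * (n - 1)) =
      q * q ^ (((t : ℤ) + 1) * n ^ 2 - (t + 1) * n) := by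
    rw [← zpow_add₀ hq0, ← zpow_one_add₀ hq0]
    ring_nf
  rw [kurAlpha, ← hpow, hsign]
  ring

theorem isBaileyPair_one_chainSum (hq0 : q ≠ 0) (hq : ‖q‖ < 1) (hI : I ⊆ Icc 1 (k - r)) {t i : ℕ}
    (hi : i + t = k) (ht : t ≤ r) :
    IsBaileyPair q 1
      (fun n => (1 - q ^ (2 * n + 1)) *
        ((-1) ^ n * q ^ ((t + 1) * n ^ 2 + (t - 1) * n) / (1 + q)))
      (chainSum (kurStep q k r I) (kurLast q) t i) := by
  induction t generalizing i with
  | zero =>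
    refine (isBaileyPair_one_iff_zero hq0 hq).2 ?_
    simp only [sub_zpow_mul_shift_eq_kurAlpha hq0, kurAlpha_zero hq]
    exact isBaileyPair_zero_alternating hq0 hq
  | succ t ih =>
    have hnot : i + 1 ∉ I := fun h => by
      have := mem_Icc.1 (hI h)
      omega
    convert! (ih (i := i + 1) (by omega) (by omega)).bailey_lemma hq0 hq le_rfl using 1
    · funext n
      have hpow : q ^ (((t + 1 : ℕ) + 1 : ℤ) * n ^ 2 + ((t + 1 : ℕ) - 1) * n) =
          q ^ (n ^ 2 + 1 * n) * q ^ (((t : ℤ) + 1) * n ^ 2 + (t - 1) * n) := by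
        rw [← zpow_add₀ hq0]
        push_cast
        ring_nf
      rw [hpow]
      ring
    · funext L
      refine Finset.sum_congr rfl fun s _ => ?_
      rw [kurStep, if_pos (by omega), if_neg hnot, mul_one, zpow_add₀ hq0, one_mul]
      norm_cast

theorem isBaileyPair_zero_chainSum (hq0 : q ≠ 0) (hq : ‖q‖ < 1) (hr : r ≤ k)
    (hI : I ⊆ Icc 1 (k - r)) {i : ℕ} (hi : i ≤ k - r) :
    IsBaileyPair q 0
      (fun n => (∏ m ∈ Ioc i (k - r), q ^ n ^ 2 * (if m ∈ I then q ^ n + q ^ (-n) else 1)) *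
        kurAlpha q r n)
      (chainSum (kurStep q k r I) (kurLast q) (k - i) i) := by
  induction hi using Nat.decreasingInduction with
  | self =>
    have h := (isBaileyPair_one_iff_zero hq0 hq).1
      (isBaileyPair_one_chainSum hq0 hq hI (by omega : k - r + r = k) le_rfl)
    simp only [sub_zpow_mul_shift_eq_kurAlpha hq0] at h
    simpa [Nat.sub_sub_self hr] using h
  | of_succ i hi ih =>
    have hIoc : Ioc i (k - r) = insert (i + 1) (Ioc (i + 1) (k - r)) := by
      ext m
      simp only [mem_insert, mem_Ioc]
      omega
    rw [show k - i = k - (i + 1) + 1 by omega]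
    simp only [hIoc, prod_insert (s := Ioc (i + 1) (k - r)) (a := i + 1) (by simp), mul_assoc]
    by_cases hmem : i + 1 ∈ I
    · convert! ih.bailey_lemma_twisted hq0 hq using 1
      · simp only [if_pos hmem]
        funext n
        ring
      · funext L
        refine Finset.sum_congr rfl fun s _ => ?_
        rw [kurStep, if_neg (by omega), if_pos hmem, mul_one]
        norm_cast
    · convert! ih.bailey_lemma hq0 hq zero_le_one using 1
      · simp only [if_neg hmem, zero_mul, add_zero, one_mul]
      · funext L
        refine Finset.sum_congr rfl fun s _ => ?_
        rw [kurStep, if_neg (by omega), if_neg hmem, mul_one, mul_one, zero_mul, add_zero]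
        norm_cast

theorem tendsto_chainSum_kurStep (hq0 : q ≠ 0) (hq : ‖q‖ < 1) (hr : r ≤ k)
    (hI : I ⊆ Icc 1 (k - r)) :
    Tendsto (chainSum (kurStep q k r I) (kurLast q) k 0) atTop
      (𝓝 (kurProductSide k r I.card q * (qPochInf q q)⁻¹)) := by
  have hpair := isBaileyPair_zero_chainSum hq0 hq hr hI (Nat.zero_le (k - r))
  have hfilter : {m ∈ Ioc 0 (k - r) | m ∈ I} = I := by
    rw [filter_mem_eq_inter]
    exact inter_eq_right.2 hI
  have halpha : ∀ n : ℤ,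
      ∏ m ∈ Ioc 0 (k - r), q ^ n ^ 2 * (if m ∈ I then q ^ n + q ^ (-n) else 1) =
        q ^ (((k : ℤ) - r) * n ^ 2) * (q ^ n + q ^ (-n)) ^ I.card := fun n => by
    rw [prod_mul_distrib, prod_const, Nat.card_Ioc, ← prod_filter, hfilter, prod_const,
      ← zpow_natCast, ← zpow_mul, Nat.sub_zero, Nat.cast_sub hr, mul_comm (n ^ 2)]
  simp only [halpha] at hpair
  convert! hpair.tendsto hq (hasSum_kurAlpha hq0 hq k r I.card) using 2
  rw [← mul_assoc, mul_inv_cancel_right₀ (qPochInf_self_ne_zero hq)]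

theorem WeakDecr.entry_succ_le (s : WeakDecr k) {i : ℕ} (hi : 1 ≤ i) :
    s.entry (i + 1) ≤ s.entry i := by
  unfold WeakDecr.entry
  split_ifs with hsucc hself
  · exact s.2 (Fin.mk_le_mk.2 (by omega))
  · omega
  · exact Nat.zero_le _
  · exact le_rfl

theorem chainEntry_succ_eq_entry (L : ℕ) (s : WeakDecr k) (m : ℕ) :
    chainEntry L s.1 (m + 1) = s.entry (m + 1) := by
  simp [chainEntry, WeakDecr.entry]

/-- The part of the summand of the multisum contributed by position `i`, apart from the
denominator. -/
noncomputable def kurWeight (q : ℂ) (r : ℕ) (I : Finset ℕ) (s : WeakDecr k) (i : ℕ) : ℂ :=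
  q ^ s.entry i ^ 2 * (if k - r < i then q ^ s.entry i else 1) *
    (if i ∈ I then kurFactor q s i else 1)

theorem prod_kurWeight_mul_kurLast (hI : I ⊆ Icc 1 k) (s : WeakDecr k) :
    (∏ i ∈ Icc 1 k, kurWeight q r I s i) * q ^ s.entry k =
      q ^ kurExponent r s * ∏ i ∈ I, kurFactor q s i := by
  have hfilter : {i ∈ Icc 1 k | k - r < i} = Icc (k - r + 1) k := by
    ext i
    simp only [mem_filter, mem_Icc]
    omega
  simp only [kurWeight]
  rw [prod_mul_distrib, prod_mul_distrib, prod_pow_eq_pow_sum, prod_ite_mem, inter_eq_right.2 hI,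
    ← prod_filter, hfilter, prod_pow_eq_pow_sum, kurExponent, pow_add, pow_add]
  ring

theorem kurStep_entry_succ (s : WeakDecr k) {i : ℕ} (hi : 1 ≤ i) :
    kurStep q k r I (i + 1) (s.entry i) (s.entry (i + 1)) =
      kurWeight q r I s (i + 1) * (qPoch q q (s.entry i - s.entry (i + 1)))⁻¹ := by
  rw [kurStep, kurWeight, kurFactor, if_neg (by omega : i + 1 ≠ 1), Nat.add_sub_cancel,
    ← Nat.cast_sub (s.entry_succ_le hi), invQFact_natCast]

theorem kurStep_one (L : ℕ) (s : WeakDecr k) :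
    kurStep q k r I 1 L (s.entry 1) = kurWeight q r I s 1 *
      ((if 1 ∈ I then 1 + q ^ (L + s.entry 1) else 1) * invQFact q (L - s.entry 1)) := by
  rw [kurStep, kurWeight, kurFactor, if_pos rfl]
  split_ifs <;> ring

theorem prod_Icc_one_eq_prod_range {M : Type*} [CommMonoid M] (f : ℕ → M) (n : ℕ) :
    ∏ i ∈ Icc 1 n, f i = ∏ i ∈ range n, f (i + 1) := by
  rw [range_eq_Ico, prod_Ico_add' f 0 n 1]
  rfl

theorem chainTerm_kurStep (hk : 1 ≤ k) (hI : I ⊆ Icc 1 k) (L : ℕ) (s : WeakDecr k) :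
    chainTerm (kurStep q k r I) (kurLast q) 0 L s.1 =
      q ^ kurExponent r s * ((∏ i ∈ I, kurFactor q s i) / kurDenom q s) *
        ((if 1 ∈ I then 1 + q ^ (L + s.entry 1) else 1) * invQFact q (L - s.entry 1)) := by
  obtain ⟨k, rfl⟩ := Nat.exists_eq_add_of_le' hk
  have hsteps : ∏ m ∈ range k, kurStep q (k + 1) r I (m + 1 + 1) (s.entry (m + 1))
        (s.entry (m + 1 + 1)) =
      (∏ m ∈ range k, kurWeight q r I s (m + 1 + 1)) *
        ∏ m ∈ range k, (qPoch q q (s.entry (m + 1) - s.entry (m + 1 + 1)))⁻¹ := by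
    rw [← prod_mul_distrib]
    exact Finset.prod_congr rfl fun m _ => kurStep_entry_succ s m.succ_pos
  have hweight := prod_kurWeight_mul_kurLast (q := q) (r := r) hI s
  rw [prod_Icc_one_eq_prod_range, prod_range_succ'] at hweight
  simp only [chainTerm, zero_add, prod_range_succ', chainEntry_succ_eq_entry, hsteps]
  rw [show chainEntry L s.1 0 = L from rfl, kurStep_one, kurLast, ← mul_div_assoc (q ^ _),
    ← hweight, kurDenom, Nat.add_sub_cancel, prod_Icc_one_eq_prod_range, prod_inv_distrib,
    div_eq_mul_inv, div_eq_mul_inv, mul_inv]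
  ring

theorem chainTerm_kurStep_eq_zero (L : ℕ) {s : Fin k → ℕ} (hs : ¬Antitone s) :
    chainTerm (kurStep q k r I) (kurLast q) 0 L s = 0 := by
  obtain _ | k := k
  · exact absurd (Subsingleton.antitone s) hs
  rw [Fin.antitone_iff_succ_le] at hs
  push Not at hs
  obtain ⟨⟨m, hm⟩, hlt⟩ := hs
  have hentries : chainEntry L s (m + 1) < chainEntry L s (m + 1 + 1) := by
    simp only [chainEntry]
    rwa [dif_pos (by omega), dif_pos (by omega)]
  rw [chainTerm, Finset.prod_eq_zero (mem_range.2 (by omega : m + 1 < k + 1)), zero_mul]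
  exact kurStep_eq_zero _ hentries

theorem tendsto_ite_one_add_pow_mul_invQFact (hq : ‖q‖ < 1) (P : Prop) [Decidable P] (n : ℕ) :
    Tendsto (fun L : ℕ => (if P then 1 + q ^ (L + n) else 1) * invQFact q (L - n)) atTop
      (𝓝 (qPochInf q q)⁻¹) := by
  have hpow : Tendsto (fun L : ℕ => 1 + q ^ (L + n)) atTop (𝓝 1) := by
    simpa using ((tendsto_pow_atTop_nhds_zero_of_norm_lt_one hq).comp
      (tendsto_add_atTop_nat n)).const_add 1
  have hone : Tendsto (fun L : ℕ => if P then 1 + q ^ (L + n) else 1) atTop (𝓝 1) := by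
    split_ifs
    exacts [hpow, tendsto_const_nhds]
  simpa only [one_mul, sub_eq_add_neg] using hone.mul (tendsto_invQFact hq (-(n : ℤ)))

theorem hasSum_kurMultisum (hq0 : q ≠ 0) (hq : ‖q‖ < 1) (hk : 1 ≤ k) (hr : r ≤ k)
    (hI : I ⊆ Icc 1 (k - r)) :
    HasSum
      (fun s : WeakDecr k => q ^ kurExponent r s * ((∏ i ∈ I, kurFactor q s i) / kurDenom q s))
      (kurProductSide k r I.card q) := by
  obtain ⟨C, hC⟩ := exists_norm_invQFact_le hq
  obtain ⟨D, hD⟩ := exists_norm_kurLast_le hq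
  have hstep := norm_kurStep_le (k := k) (r := r) (I := I) hq0 hq hC
  have hb : Summable fun s : ℕ => ‖q ^ ((s : ℤ) ^ 2 - s)‖ * (2 * C) := by
    simpa using (summable_nat_zpow_mul_zpow_sq_sub hq0 hq one_ne_zero).norm.mul_right (2 * C)
  have hbound := ((summable_prod_pi (fun s => (norm_nonneg _).trans (hstep 0 0 s)) hb k).mul_right
    D).subtype {s | Antitone s}
  have hsum : ∀ L, HasSum (fun s : WeakDecr k => chainTerm (kurStep q k r I) (kurLast q) 0 L s.1)
      (chainSum (kurStep q k r I) (kurLast q) k 0 L) := fun L =>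
    (hasSum_subtype_iff_of_support_subset fun s hs => by
      by_contra hnot
      exact hs (chainTerm_kurStep_eq_zero L hnot)).2
    (hasSum_chainTerm hb hstep hD (fun i _ _ => kurStep_eq_zero i) 0 L)
  have hlimit := hasSum_of_tendsto_of_dominated hbound
    (fun L s => norm_chainTerm_le hstep hD 0 L s.1) (fun s => by
      simp only [chainTerm_kurStep hk (hI.trans (Icc_subset_Icc_right (Nat.sub_le k r)))]
      exact (tendsto_ite_one_add_pow_mul_invQFact hq _ _).const_mul _)
    hsum (tendsto_chainSum_kurStep hq0 hq hr hI)
  exact (hasSum_mul_right_iff (inv_ne_zero (qPochInf_self_ne_zero hq))).1 hlimit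

theorem prod_Icc_kurFactor (hq0 : q ≠ 0) (s : WeakDecr k) (j : ℕ) :
    ∏ i ∈ Icc 1 j, kurFactor q s i =
      q ^ (-∑ i ∈ Icc 1 j, (s.entry i : ℤ)) *
        ∏ i ∈ Icc 1 (j - 1), (1 + q ^ (s.entry i + s.entry (i + 1))) := by
  induction j with
  | zero => simp
  | succ j ih =>
    obtain rfl | ⟨j, rfl⟩ : j = 0 ∨ ∃ m, j = m + 1 := by
      cases j <;> simp
    · simp [kurFactor]
    have hprod := prod_Icc_succ_top (by omega : 1 ≤ j + 1)
      fun i => 1 + q ^ (s.entry i + s.entry (i + 1))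
    rw [prod_Icc_succ_top (by omega), sum_Icc_succ_top (by omega), ih, Nat.add_sub_cancel,
      Nat.add_sub_cancel, hprod, kurFactor, if_neg (by omega), Nat.add_sub_cancel, neg_add,
      zpow_add₀ hq0]
    ring

end Multisum

theorem mainTheorem2 (q : ℂ) (hq0 : q ≠ 0) (hq1 : ‖q‖ < 1)
    (k r j : ℕ) (hk : 1 ≤ k) (hjr : j + r ≤ k) :
    HasSum
      (fun s : WeakDecr k =>
        q ^ kurExponent r s *
          ((q ^ (-∑ i ∈ Finset.Icc 1 j, (s.entry i : ℤ)) *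
              ∏ i ∈ Finset.Icc 1 (j - 1), (1 + q ^ (s.entry i + s.entry (i + 1)))) /
            kurDenom q s))
      (kurProductSide k r j q) ∧
    ∀ I : Finset ℕ, I ⊆ insert 1 (Finset.Icc 2 (k - r)) → I.card = j →
      HasSum
        (fun s : WeakDecr k =>
          q ^ kurExponent r s * ((∏ i ∈ I, kurFactor q s i) / kurDenom q s))
        (kurProductSide k r j q) := by
  have hr : r ≤ k := by omega
  constructor
  · have hIcc : Icc 1 j ⊆ Icc 1 (k - r) := Icc_subset_Icc_right (by omega)
    simpa only [prod_Icc_kurFactor hq0, Nat.card_Icc, Nat.add_sub_cancel] using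
      hasSum_kurMultisum hq0 hq1 hk hr hIcc
  · rintro I hI rfl
    refine hasSum_kurMultisum hq0 hq1 hk hr fun i hi => ?_
    have hcard : 1 ≤ I.card := card_pos.2 ⟨i, hi⟩
    have hmem := hI hi
    simp only [mem_insert, mem_Icc] at hmem ⊢
    omega
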